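/- Let $L\ge 2$ be an integer. A binary code $\mathcal C\subseteq\mathbb F_2^n$ is called $(p,L-1)$-list decodable if for every $y\in\mathbb F_2^n$ fewer than $L$ codewords $x\in\mathcal C$ satisfy $d_H(x,y)\le np$, where $d_H$ is the Hamming distance. The rate of $\mathcal C$ is $R(\mathcal C)=\frac{\log_2|\mathcal C|}{n}$ (with rate $0$ for the empty code). The $(p,L-1)$-list decoding capacity is $$C_{L-1}(p)=\limsup_{n\to\infty}\ \max\{R(\mathcal C):\ \mathcal C\subseteq\mathbb F_2^n\text{ is }(p,L-1)\text{-list decodable}\},$$ and the Plotkin point $P_{L-1}=\inf\{p\ge 0:\ C_{L-1}(p)=0\}$ is the value of $p$ at which the capacity hits zero. Let $$r=\mathbb E\,|x_1+\dots+x_L|,$$ where $x_1,\dots,x_L$ are independent and uniformly distributed on $\{-1,1\}$ (the expected distance from the origin of an unbiased one-dimensional random walk after $L$ steps). Then: 1. $$P_{L-1}=\frac{1-r/L}{2}.$$ 2. (Lower bound) If $0\le p<\frac{1-r/L}{2}$, then $C_{L-1}(p)>0$, and for some $R>0$ there is an infinite sequence of $(p,L-1)$-list decodable codes, with blocklengths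 tending to infinity, all of rate at least $R$. 3. (Upper bound) If $p>\frac{1-r/L}{2}$, then $C_{L-1}(p)=0$, and there is no $R>0$ for which such an infinite sequence of codes exists. 4. (Agreement with the formulas of Blinovsky and of Alon–Bukh–Polyanskiy) If $L=2k$ or $L=2k+1$ with an integer $k\ge1$, then $$\frac{1-r/L}{2}=\sum_{i=1}^{k}\frac{\binom{2(i-1)}{i-1}}{i}\,2^{-2i}=\frac12-2^{-2k-1}\binom{2k}{k}.$$ -/

import Mathlib

namespace BitFlip

open Filter

/-- A binary code `C ⊆ 𝔽₂ⁿ` is `(p, L-1)`-list decodable: every closed Hamming ball of radius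
`n * p` contains fewer than `L` codewords. -/
def IsListDecodable {n : ℕ} (p : ℝ) (L : ℕ) (C : Finset (Fin n → ZMod 2)) : Prop :=
  ∀ y : Fin n → ZMod 2, (C.filter fun x => (hammingDist x y : ℝ) ≤ n * p).card < L

/-- The rate `log₂ |C| / n` of a binary code of blocklength `n`. -/
noncomputable def rate {n : ℕ} (C : Finset (Fin n → ZMod 2)) : ℝ :=
  Real.logb 2 C.card / n

/-- The largest rate of a `(p, L-1)`-list decodable code of blocklength `n`
(the supremum is over a finite set, which contains the rate of the empty code when `1 ≤ L`). -/
noncomputable def maxRate (L : ℕ) (p : ℝ) (n : ℕ) : ℝ :=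
  sSup {R : ℝ | ∃ C : Finset (Fin n → ZMod 2), IsListDecodable p L C ∧ R = rate C}

/-- The `(p, L-1)`-list decoding capacity. -/
noncomputable def capacity (L : ℕ) (p : ℝ) : ℝ :=
  limsup (fun n : ℕ => maxRate L p n) atTop

/-- The Plotkin point for `(p, L-1)`-list decoding: the value of `p` at which the capacity
hits zero. -/
noncomputable def plotkinPoint (L : ℕ) : ℝ :=
  sInf {p : ℝ | 0 ≤ p ∧ capacity L p = 0}

/-- There is an infinite sequence of `(p, L-1)`-list decodable codes, with blocklengths tending
to infinity, whose rates are all at least `R`. -/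
def IsAchievable (L : ℕ) (p R : ℝ) : Prop :=
  ∃ (n : ℕ → ℕ) (C : ∀ i, Finset (Fin (n i) → ZMod 2)), Tendsto n atTop atTop ∧
    ∀ i, IsListDecodable p L (C i) ∧ R ≤ rate (C i)

/-- `E |x₁ + ⋯ + x_L|` for `(x₁, …, x_L)` uniformly distributed on `{-1, 1}^L`, that is, for
independent uniform `±1` steps. -/
noncomputable def walkDistance (L : ℕ) : ℝ :=
  (∑ x ∈ Fintype.piFinset fun _ : Fin L => ({-1, 1} : Finset ℝ), |∑ i, x i|) / 2 ^ L

end BitFlip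

namespace BitFlip

open Filter

/-! The bitwise majority of `L` words minimises the sum of their distances to a common centre. If
the signs in a column sum to `s`, the column contributes `(L - |s|) / 2`. For random words the mean
of this is `(L - r) / 2`, that is, `threshold L` per word and coordinate.

Below the threshold, a Chernoff bound (`card_clustered_le`, `exists_chernoff_lt`) makes it
exponentially unlikely that `L` random words share a ball, and a union bound
(`exists_not_clustered`) yields exponentially many words without such a tuple.

Above it, Ramsey's theorem finds in any large code `K` words with nearly symmetric joint statistics.
A random `L`-tuple of them makes each column a walk with possibly biased steps. Bias only increases
the expected distance (`walkDistance_le_sum`), so some tuple of distinct words has a small mean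
distance to its majority word. By near symmetry its individual distances are almost equal, hence all
small (`exists_center`). So code sizes are bounded and rates tend to `0`. -/

/-! ### One-dimensional random walks -/

/-- The `±1` encoding of a bit. -/
def spin (b : ZMod 2) : ℤ := if b = 0 then 1 else -1

lemma spin_zero : spin 0 = 1 := rfl

lemma spin_one : spin 1 = -1 := rfl

lemma zmod_two_eq (b : ZMod 2) : b = 0 ∨ b = 1 := by
  revert b; decide

lemma spin_eq (b : ZMod 2) : spin b = 1 ∨ spin b = -1 := by
  revert b; decide

/-- One step of a random walk on `ℤ`, acting on functions: up with probability `p`, down with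
probability `1 - p`. -/
noncomputable def step (p : ℝ) (h : ℤ → ℝ) (t : ℤ) : ℝ := p * h (t + 1) + (1 - p) * h (t - 1)

lemma step_comm (p q : ℝ) : Function.Commute (step p) (step q) := by
  intro h
  funext t
  simp only [step, sub_add_cancel, add_sub_cancel_right]
  ring

lemma step_iterate_add (p : ℝ) (l : ℕ) (g h : ℤ → ℝ) :
    (step p)^[l] (fun t => g t + h t) = fun t => (step p)^[l] g t + (step p)^[l] h t := by
  induction l generalizing g h with
  | zero => rfl
  | succ l ih =>
    have : step p (fun t => g t + h t) = fun t => step p g t + step p h t := by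
      funext t; simp only [step]; ring
    simp only [Function.iterate_succ_apply, this, ih]

/-- Even functions on `ℤ` that grow with `|t|` along each parity class. -/
structure EvenMono (h : ℤ → ℝ) : Prop where
  even : ∀ t, h (-t) = h t
  le : ∀ a : ℕ, h (a - 1) ≤ h (a + 1)

lemma evenMono_abs : EvenMono fun t => ((|t| : ℤ) : ℝ) where
  even t := by simp
  le a := by
    have : |(a : ℤ) - 1| ≤ |(a : ℤ) + 1| := by
      rw [abs_of_nonneg (by positivity : (0 : ℤ) ≤ a + 1), abs_le]; omega
    exact_mod_cast this

lemma EvenMono.step_half {h : ℤ → ℝ} (hh : EvenMono h) : EvenMono (step (1 / 2) h) where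
  even t := by
    have h1 := hh.even (t - 1)
    have h2 := hh.even (t + 1)
    simp only [step]
    rw [show -t + 1 = -(t - 1) by ring, show -t - 1 = -(t + 1) by ring, h1, h2]
    ring
  le a := by
    simp only [step, sub_add_cancel, add_sub_cancel_right]
    have h1 := hh.le (a + 1)
    rcases a with _ | b
    · have h2 := hh.even 2
      norm_num at h1 h2 ⊢
      linarith
    · have h2 := hh.le b
      push_cast at h1 h2 ⊢
      ring_nf at h1 h2 ⊢
      linarith

/-- Induction with `step (1 / 2) h` in place of `h`: its value at `a` averages `h (a + 1)` with the
smaller `h (a - 1)`. -/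
lemma EvenMono.iterate_zero_le {h : ℤ → ℝ} (hh : EvenMono h) (a : ℕ) :
    (step (1 / 2))^[a] h 0 ≤ h a := by
  induction a generalizing h with
  | zero => simp
  | succ a ih =>
    rw [Function.iterate_succ_apply]
    refine (ih hh.step_half).trans ?_
    have := hh.le a
    simp only [step]
    push_cast
    linarith

/-- An upward drift increases the expectation of an `EvenMono` function of a random walk. -/
lemma EvenMono.iterate_le {h : ℤ → ℝ} (hh : EvenMono h) {p : ℝ} (hp : 1 / 2 ≤ p) (hp1 : p ≤ 1)
    (l a : ℕ) : (step (1 / 2))^[l + a] h 0 ≤ (step p)^[l] h a := by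
  induction l generalizing h a with
  | zero => simpa using hh.iterate_zero_le a
  | succ l ih =>
    -- With `X` the `l`-fold iterate, `step p X a = (2p - 1) * X (a + 1) + 2(1 - p) * step (1 / 2) X
    -- a`. The weights are nonnegative, and `h1`, `h2` bound both values from below by the unbiased
    -- walk.
    have h1 := ih hh (a + 1)
    have h2 := ih hh.step_half a
    rw [((step_comm p (1 / 2)).iterate_left l).eq h, ← Function.iterate_succ_apply] at h2
    rw [Function.iterate_succ_apply' (step p)]
    rw [show l + (a + 1) = l + 1 + a by ring] at h1
    rw [show (l + a).succ = l + 1 + a by omega] at h2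
    set X := (step p)^[l] h
    simp only [step] at h2 ⊢
    push_cast at h1
    nlinarith

/-- The sum over all sequences of `±1` steps, as an iterate of `step`. -/
lemma sum_walk {ι : Type*} [Fintype ι] (ξ : ι → ℤ) (p : ℝ) {K : ℝ}
    (hξ : ∀ (h : ℤ → ℝ) (t : ℤ), ∑ k, h (t + ξ k) = K * step p h t) (l : ℕ) (h : ℤ → ℝ) (t : ℤ) :
    ∑ φ : Fin l → ι, h (t + ∑ i, ξ (φ i)) = K ^ l * (step p)^[l] h t := by
  induction l generalizing h t with
  | zero => simp
  | succ l ih =>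
    rw [← (Fin.consEquiv fun _ => ι).sum_comp, Fintype.sum_prod_type, Finset.sum_comm]
    simp only [Fin.consEquiv_apply, Fin.sum_univ_succ, Fin.cons_zero, Fin.cons_succ]
    have : ∀ φ : Fin l → ι, ∑ k, h (t + (ξ k + ∑ i, ξ (φ i)))
        = K * step p h (t + ∑ i, ξ (φ i)) := by
      intro φ
      rw [← hξ]
      refine Finset.sum_congr rfl fun k _ => ?_
      congr 1; ring
    rw [Finset.sum_congr rfl fun φ _ => this φ, ← Finset.mul_sum, ih, Function.iterate_succ_apply]
    ring

lemma sum_spin (h : ℤ → ℝ) (t : ℤ) : ∑ b, h (t + spin b) = 2 * step (1 / 2) h t := by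
  have : ∑ b, h (t + spin b) = h (t + spin 0) + h (t + spin 1) := Fin.sum_univ_two _
  rw [this, spin_zero, spin_one, step, sub_eq_add_neg t]
  ring

lemma sum_spin_walk (l : ℕ) (h : ℤ → ℝ) :
    ∑ u : Fin l → ZMod 2, h (∑ i, spin (u i)) = 2 ^ l * (step (1 / 2))^[l] h 0 := by
  simpa using sum_walk spin (1 / 2) sum_spin l h 0

lemma sum_abs_spin (L : ℕ) :
    ∑ u : Fin L → ZMod 2, ((|∑ i, spin (u i)| : ℤ) : ℝ) = 2 ^ L * walkDistance L := by
  rw [walkDistance, mul_div_cancel₀ _ (by positivity)]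
  have hs : ∀ x : ℝ, x ∈ ({-1, 1} : Finset ℝ) →
      ((spin (if x = 1 then 0 else 1) : ℤ) : ℝ) = x := by
    intro x hx
    simp only [Finset.mem_insert, Finset.mem_singleton] at hx
    rcases hx with rfl | rfl <;> norm_num [spin]
  symm
  refine Finset.sum_bij' (fun x _ i => if x i = 1 then 0 else 1) (fun u _ i => (spin (u i) : ℝ))
    (by simp) ?_ ?_ ?_ ?_
  · intro u _
    simp only [Fintype.mem_piFinset, Finset.mem_insert, Finset.mem_singleton]
    intro i
    rcases spin_eq (u i) with h | h <;> simp [h]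
  · intro x hx
    funext i
    exact hs _ (Fintype.mem_piFinset.1 hx i)
  · intro u _
    funext i
    rcases zmod_two_eq (u i) with h | h <;> norm_num [h, spin]
  · intro x hx
    push_cast
    congr 1
    exact Finset.sum_congr rfl fun i _ => (hs _ (Fintype.mem_piFinset.1 hx i)).symm

lemma walkDistance_eq_iterate (L : ℕ) :
    walkDistance L = (step (1 / 2))^[L] (fun t => ((|t| : ℤ) : ℝ)) 0 := by
  have h1 := sum_abs_spin L
  rw [sum_spin_walk L fun t => ((|t| : ℤ) : ℝ)] at h1
  exact (mul_left_cancel₀ (by positivity) h1).symm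

/-- Among random walks with `±1` steps, the unbiased one has the least expected distance. -/
lemma walkDistance_le_sum {ι : Type*} [Fintype ι] [Nonempty ι] (ξ : ι → ℤ)
    (hξ : ∀ k, ξ k = 1 ∨ ξ k = -1) (L : ℕ) :
    (Fintype.card ι : ℝ) ^ L * walkDistance L
      ≤ ∑ φ : Fin L → ι, ((|∑ i, ξ (φ i)| : ℤ) : ℝ) := by
  wlog hpos : 0 ≤ ∑ k, ξ k generalizing ξ
  · have := this (fun k => -ξ k) (fun k => by rcases hξ k with h | h <;> simp [h])
      (by rw [Finset.sum_neg_distrib]; omega)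
    simpa only [Finset.sum_neg_distrib, abs_neg] using this
  have hK : (0 : ℝ) < Fintype.card ι := by exact_mod_cast Fintype.card_pos
  set K : ℝ := (Fintype.card ι : ℝ)
  set s : ℝ := ∑ k, (ξ k : ℝ) with hs
  have hs0 : 0 ≤ s := by rw [hs]; exact_mod_cast hpos
  have hsK : s ≤ K := by
    calc s ≤ ∑ _k : ι, (1 : ℝ) := Finset.sum_le_sum fun k _ => by
          rcases hξ k with h | h <;> norm_num [h]
      _ = K := by simp [K]
  -- For uniform `k` the mean step is `s / K`, so the step goes up with probability `(1 + s / K) /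
  -- 2`.
  have hstep : ∀ (h : ℤ → ℝ) (t : ℤ), ∑ k, h (t + ξ k) = K * step ((1 + s / K) / 2) h t := by
    intro h t
    have h1 : ∀ k, h (t + ξ k)
        = (1 + (ξ k : ℝ)) / 2 * h (t + 1) + (1 - (ξ k : ℝ)) / 2 * h (t - 1) := by
      intro k
      rcases hξ k with h' | h' <;> rw [h'] <;> norm_num [sub_eq_add_neg]
    rw [Finset.sum_congr rfl fun k _ => h1 k, Finset.sum_add_distrib, ← Finset.sum_mul,
      ← Finset.sum_mul, ← Finset.sum_div, ← Finset.sum_div, Finset.sum_add_distrib,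
      Finset.sum_sub_distrib, ← hs, step]
    simp only [Finset.sum_const, Finset.card_univ, nsmul_eq_mul, mul_one]
    field_simp
    ring
  have h2 := sum_walk ξ _ hstep L (fun t => ((|t| : ℤ) : ℝ)) 0
  simp only [zero_add] at h2
  rw [h2, walkDistance_eq_iterate]
  have hr0 : 0 ≤ s / K := by positivity
  have hr1 : s / K ≤ 1 := (div_le_one hK).2 hsK
  have := evenMono_abs.iterate_le (p := (1 + s / K) / 2) (by linarith) (by linarith) L 0
  simp only [add_zero, Nat.cast_zero] at this
  gcongr

/-! ### Return probabilities and closed forms of the expected distance. -/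

lemma sum_spin_eq (l : ℕ) (u : Fin l → ZMod 2) :
    ∑ i, spin (u i) = l - 2 * (Finset.univ.filter fun i => u i = 1).card := by
  have : ∀ b : ZMod 2, spin b = 1 - 2 * (if b = 1 then 1 else 0) := by decide
  simp only [this, Finset.sum_sub_distrib, ← Finset.mul_sum, Finset.sum_boole]
  simp

lemma card_walk_return (k : ℕ) :
    (Finset.univ.filter fun u : Fin (2 * k) → ZMod 2 => ∑ i, spin (u i) = 0).card
      = (2 * k).choose k := by
  have : (2 * k).choose k = (Finset.powersetCard k (Finset.univ : Finset (Fin (2 * k)))).card := by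
    simp
  rw [this]
  refine Finset.card_nbij' (fun u => Finset.univ.filter fun i => u i = 1)
    (fun A i => if i ∈ A then 1 else 0) ?_ ?_ ?_ ?_
  · intro u hu
    simp only [Finset.coe_filter, Finset.mem_univ, true_and, Set.mem_ofPred_eq] at hu
    rw [sum_spin_eq] at hu
    push_cast at hu
    simp only [Finset.mem_coe, Finset.mem_powersetCard,
      Finset.subset_univ, true_and]
    omega
  · intro A hA
    simp only [Finset.mem_coe, Finset.mem_powersetCard, Finset.subset_univ, true_and] at hA
    simp only [Finset.coe_filter, Finset.mem_univ, true_and, Set.mem_ofPred_eq]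
    rw [sum_spin_eq]
    simp [hA]
  · intro u _
    funext i
    rcases zmod_two_eq (u i) with h | h <;> simp [h]
  · intro A _
    ext i
    simp

/-- An unbiased step preserves the mean of `|t|` except at `t = 0`, where it adds `1`; the expected
distance counts the visits to `0`. -/
lemma walkDistance_succ (l : ℕ) :
    walkDistance (l + 1)
      = walkDistance l + (step (1 / 2))^[l] (fun t => if t = 0 then 1 else 0) 0 := by
  have : step (1 / 2) (fun t => ((|t| : ℤ) : ℝ))
      = fun t => ((|t| : ℤ) : ℝ) + if t = 0 then 1 else 0 := by
    funext t
    simp only [step]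
    rcases lt_trichotomy t 0 with h | rfl | h
    · rw [if_neg h.ne, abs_of_neg h, abs_of_nonpos (by omega : t + 1 ≤ 0),
        abs_of_neg (by omega : t - 1 < 0)]
      push_cast; ring
    · norm_num
    · rw [if_neg h.ne', abs_of_pos h, abs_of_pos (by omega : 0 < t + 1),
        abs_of_nonneg (by omega : 0 ≤ t - 1)]
      push_cast; ring
  rw [walkDistance_eq_iterate, walkDistance_eq_iterate, Function.iterate_succ_apply, this,
    step_iterate_add]

lemma iterate_return_even (k : ℕ) :
    (step (1 / 2))^[2 * k] (fun t => if t = 0 then 1 else 0) 0 = (2 * k).choose k / 4 ^ k := by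
  have h := sum_spin_walk (2 * k) fun t => if t = 0 then 1 else 0
  rw [Finset.sum_boole, card_walk_return, pow_mul] at h
  rw [h]
  field_simp
  norm_num

lemma iterate_return_odd (k : ℕ) :
    (step (1 / 2))^[2 * k + 1] (fun t => if t = 0 then 1 else 0) 0 = 0 := by
  have h := sum_spin_walk (2 * k + 1) fun t => if t = 0 then 1 else 0
  rw [Finset.sum_eq_zero] at h
  · simpa using h.symm
  · intro u _
    rw [if_neg]
    rw [sum_spin_eq]
    push_cast
    omega

lemma walkDistance_even (k : ℕ) :
    walkDistance (2 * k) = (2 * k) * ((2 * k).choose k / 4 ^ k) := by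
  induction k with
  | zero => simp [walkDistance_eq_iterate]
  | succ k ih =>
    have h1 : (k + 1 : ℝ) * (2 * (k + 1)).choose (k + 1) = 2 * (2 * k + 1) * (2 * k).choose k := by
      exact_mod_cast Nat.succ_mul_centralBinom_succ k
    rw [show 2 * (k + 1) = 2 * k + 1 + 1 by ring] at *
    rw [walkDistance_succ, iterate_return_odd, walkDistance_succ, ih, iterate_return_even]
    push_cast
    rw [show (2 * ((k : ℝ) + 1)) * (((2 * k + 1 + 1).choose (k + 1) : ℕ) / 4 ^ (k + 1))
      = 2 * ((k + 1) * (2 * k + 1 + 1).choose (k + 1)) / 4 ^ (k + 1) by ring, h1, pow_succ]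
    field_simp
    ring

lemma walkDistance_odd (k : ℕ) :
    walkDistance (2 * k + 1) = (2 * k + 1) * ((2 * k).choose k / 4 ^ k) := by
  rw [walkDistance_succ, walkDistance_even, iterate_return_even]
  ring

/-- The value of `p` at which the capacity will turn out to vanish. -/
noncomputable def threshold (L : ℕ) : ℝ := (1 - walkDistance L / L) / 2

lemma threshold_eq {L k : ℕ} (hk : 1 ≤ k) (h : L = 2 * k ∨ L = 2 * k + 1) :
    threshold L = 1 / 2 - (2 * k).choose k / 4 ^ k / 2 := by
  have hk' : (0 : ℝ) < k := by exact_mod_cast hk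
  rcases h with rfl | rfl
  · rw [threshold, walkDistance_even]
    push_cast
    field_simp
  · rw [threshold, walkDistance_odd]
    push_cast
    field_simp

lemma threshold_eq_sum {L k : ℕ} (hk : 1 ≤ k) (h : L = 2 * k ∨ L = 2 * k + 1) :
    threshold L = ∑ i ∈ Finset.Icc 1 k,
      ((2 * (i - 1)).choose (i - 1) : ℝ) / (i : ℝ) * (2 : ℝ) ^ (-(2 * (i : ℤ))) := by
  rw [threshold_eq hk h]
  -- The closed form equals the sum already at `k = 0`, so the induction starts there; its step is
  -- the central binomial recurrence.
  clear h hk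
  induction k with
  | zero => norm_num
  | succ k ih =>
    rw [Finset.sum_Icc_succ_top (by omega), ← ih, zpow_neg, zpow_mul]
    have h1 : (k + 1 : ℝ) * (2 * (k + 1)).choose (k + 1) = 2 * (2 * k + 1) * (2 * k).choose k := by
      exact_mod_cast Nat.succ_mul_centralBinom_succ k
    rw [zpow_natCast, eq_div_of_mul_eq (by positivity) ((mul_comm _ _).trans h1)]
    norm_num [pow_succ]
    field_simp
    ring

lemma threshold_nonneg {L : ℕ} (hL : 2 ≤ L) : 0 ≤ threshold L := by
  rw [threshold_eq_sum (k := L / 2) (by omega) (by omega)]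
  positivity

lemma threshold_eq_zpow {L k : ℕ} (hk : 1 ≤ k) (h : L = 2 * k ∨ L = 2 * k + 1) :
    threshold L = 1 / 2 - (2 : ℝ) ^ (-(2 * (k : ℤ)) - 1) * ((2 * k).choose k : ℝ) := by
  rw [threshold_eq hk h, zpow_sub₀ (by norm_num), zpow_neg, zpow_mul, zpow_natCast]
  norm_num
  field_simp

/-! ### Ramsey's theorem for hypergraphs -/

/-- Ramsey's theorem: for every `q`-colouring of the `s`-subsets of a large set there is a
subset with at least `K` elements all of whose `s`-subsets have the same colour. -/
lemma ramsey_uniform (q s K : ℕ) : ∃ N : ℕ, ∀ X : Finset ℕ, N ≤ X.card → ∀ χ : Finset ℕ → ℕ,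
    (∀ S, χ S < q) → ∃ Y ⊆ X, K ≤ Y.card ∧ ∃ c < q, ∀ S ⊆ Y, S.card = s → χ S = c := by
  induction s generalizing K with
  | zero =>
    refine ⟨K, fun X hX χ hχ => ⟨X, subset_rfl, hX, χ ∅, hχ _, fun S _ hS => ?_⟩⟩
    rw [Finset.card_eq_zero.1 hS]
  | succ s ih =>
    -- In `Y` the colour of an `s + 1`-set depends only on its least element. Such a `Y` is built by
    -- removing the minimum `a` and making `S ↦ χ (insert a S)` constant through `ih`.
    have key : ∀ m : ℕ, ∃ N : ℕ, ∀ X : Finset ℕ, N ≤ X.card → ∀ χ : Finset ℕ → ℕ,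
        (∀ S, χ S < q) → ∃ Y ⊆ X, m ≤ Y.card ∧ ∃ γ : ℕ → ℕ, (∀ a, γ a < q) ∧
          ∀ a ∈ Y, ∀ S ⊆ Y, (∀ b ∈ S, a < b) → S.card = s → χ (insert a S) = γ a := by
      intro m
      induction m with
      | zero =>
        exact ⟨0, fun X _ χ hχ => ⟨∅, Finset.empty_subset _, le_rfl, fun _ => χ ∅, fun _ => hχ _,
          by simp⟩⟩
      | succ m ihm =>
        obtain ⟨N₁, h₁⟩ := ihm
        obtain ⟨N, hN⟩ := ih N₁
        refine ⟨N + 1, fun X hX χ hχ => ?_⟩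
        have hne : X.Nonempty := Finset.card_pos.1 (by omega)
        set a := X.min' hne
        have haX : a ∈ X := X.min'_mem hne
        obtain ⟨X', hX', hcard, c, hcq, hc⟩ := hN (X.erase a)
          (by rw [Finset.card_erase_of_mem haX]; omega) (fun S => χ (insert a S)) fun S => hχ _
        obtain ⟨Y, hY, hYm, γ, hγ, hγY⟩ := h₁ X' hcard χ hχ
        have hlt : ∀ b ∈ Y, a < b := fun b hb => X.min'_lt_of_mem_erase_min' hne (hX' (hY hb))
        have haY : a ∉ Y := fun h => lt_irrefl _ (hlt a h)
        have hsub : ∀ b ∈ insert a Y, ∀ S ⊆ insert a Y, (∀ b' ∈ S, b < b') → S ⊆ Y := by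
          intro b hb S hS hbS b' hb'
          refine (Finset.mem_insert.1 (hS hb')).resolve_left fun h => ?_
          have h1 := hbS b' hb'
          rcases Finset.mem_insert.1 hb with rfl | h2
          · omega
          · have := hlt b h2; omega
        refine ⟨insert a Y, ?_, ?_, fun b => if b = a then c else γ b, ?_, ?_⟩
        · exact Finset.insert_subset haX
            ((hY.trans hX').trans (Finset.erase_subset _ _))
        · rw [Finset.card_insert_of_notMem haY]; omega
        · intro b
          dsimp only
          split_ifs
          exacts [hcq, hγ b]
        · intro b hb S hS hbS hSs
          have hSY := hsub b hb S hS hbS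
          dsimp only
          split_ifs with hba
          · rw [hba]
            exact hc S (hSY.trans hY) hSs
          · exact hγY b ((Finset.mem_insert.1 hb).resolve_left hba) S hSY hbS hSs
    obtain ⟨N, hN⟩ := key (q * K + 1)
    refine ⟨N, fun X hX χ hχ => ?_⟩
    obtain ⟨Y, hYX, hYm, γ, hγ, hγY⟩ := hN X hX χ hχ
    -- Pigeonhole: some value of `γ` occurs at more than `K` elements.
    obtain ⟨c, hcq, hc⟩ := Finset.exists_lt_card_fiber_of_mul_lt_card_of_maps_to
      (s := Y) (t := Finset.range q) (f := γ) (n := K) (fun a _ => Finset.mem_range.2 (hγ a))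
      (by simpa using hYm)
    refine ⟨_, (Finset.filter_subset _ _).trans hYX, hc.le, c, Finset.mem_range.1 hcq, ?_⟩
    intro S hS hSs
    have hne : S.Nonempty := Finset.card_pos.1 (by omega)
    have hm := Finset.mem_filter.1 (hS (S.min'_mem hne))
    rw [← hm.2, ← hγY _ hm.1 (S.erase (S.min' hne)), Finset.insert_erase (S.min'_mem hne)]
    · exact (Finset.erase_subset _ _).trans (hS.trans (Finset.filter_subset _ _))
    · exact fun b hb => S.min'_lt_of_mem_erase_min' hne hb
    · rw [Finset.card_erase_of_mem (S.min'_mem hne)]; omega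

/-- Ramsey's theorem, simultaneously for all uniformities up to `L`. -/
lemma ramsey_le (q L K : ℕ) : ∃ N : ℕ, ∀ X : Finset ℕ, N ≤ X.card → ∀ χ : Finset ℕ → ℕ,
    (∀ S, χ S < q) → ∃ Y ⊆ X, Y.card = K ∧
      ∀ S ⊆ Y, ∀ S' ⊆ Y, S.card = S'.card → S.card ≤ L → χ S = χ S' := by
  induction L with
  | zero =>
    refine ⟨K, fun X hX χ _ => ?_⟩
    obtain ⟨Y, hY, hYK⟩ := Finset.exists_subset_card_eq hX
    refine ⟨Y, hY, hYK, fun S _ S' _ h h0 => ?_⟩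
    have h1 := Nat.le_zero.1 h0
    rw [Finset.card_eq_zero.1 h1, Finset.card_eq_zero.1 (h.symm.trans h1)]
  | succ L ih =>
    obtain ⟨N₁, h₁⟩ := ih
    obtain ⟨N, hN⟩ := ramsey_uniform q (L + 1) N₁
    refine ⟨N, fun X hX χ hχ => ?_⟩
    obtain ⟨Y, hYX, hYm, c, -, hc⟩ := hN X hX χ hχ
    obtain ⟨Z, hZY, hZK, hZ⟩ := h₁ Y hYm χ hχ
    refine ⟨Z, hZY.trans hYX, hZK, fun S hS S' hS' h hL => ?_⟩
    rcases Nat.lt_or_ge L S.card with h' | h'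
    · rw [hc S (hS.trans hZY) (by omega), hc S' (hS'.trans hZY) (by omega)]
    · exact hZ S hS S' hS' h h'

/-! ### Statistics of tuples of codewords -/

/-- The number of coordinates in which all the words `x j`, `j ∈ S`, have a one. -/
def onesCount {n : ℕ} (x : ℕ → Fin n → ZMod 2) (S : Finset ℕ) : ℕ :=
  (Finset.univ.filter fun c => ∀ j ∈ S, x j c = 1).card

/-- The sum over all coordinates `c` of `g` at the `c`-th entries of the words `x (φ i)`. -/
def coordSum {n L : ℕ} (x : ℕ → Fin n → ZMod 2) (g : (Fin L → ZMod 2) → ℝ) (φ : Fin L → ℕ) : ℝ :=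
  ∑ c, g fun i => x (φ i) c

/-- A statistic `g` of `L`-tuples of bits is stable if its coordinate sum depends little on the
choice of distinct words from a family in which the numbers `onesCount x S` depend little on `S`,
given its size. -/
def IsStable {L : ℕ} (g : (Fin L → ZMod 2) → ℝ) : Prop :=
  ∃ B : ℝ, 0 ≤ B ∧ ∀ (n : ℕ) (x : ℕ → Fin n → ZMod 2) (Y : Finset ℕ) (δ : ℝ),
    (∀ S ⊆ Y, ∀ S' ⊆ Y, S.card = S'.card → S.card ≤ L →
      |(onesCount x S : ℝ) - onesCount x S'| ≤ δ) →
    ∀ φ ψ : Fin L → ℕ, φ.Injective → ψ.Injective → (∀ i, φ i ∈ Y) → (∀ i, ψ i ∈ Y) →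
      |coordSum x g φ - coordSum x g ψ| ≤ B * δ

lemma IsStable.add {L : ℕ} {g h : (Fin L → ZMod 2) → ℝ} (hg : IsStable g) (hh : IsStable h) :
    IsStable fun u => g u + h u := by
  obtain ⟨B, hB, hg⟩ := hg
  obtain ⟨B', hB', hh⟩ := hh
  refine ⟨B + B', add_nonneg hB hB', fun n x Y δ hY φ ψ h1 h2 h3 h4 => ?_⟩
  have e1 := hg n x Y δ hY φ ψ h1 h2 h3 h4
  have e2 := hh n x Y δ hY φ ψ h1 h2 h3 h4
  simp only [coordSum, Finset.sum_add_distrib] at e1 e2 ⊢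
  rw [add_sub_add_comm, add_mul]
  exact (abs_add_le _ _).trans (add_le_add e1 e2)

lemma IsStable.const_mul {L : ℕ} {g : (Fin L → ZMod 2) → ℝ} (hg : IsStable g) (a : ℝ) :
    IsStable fun u => a * g u := by
  obtain ⟨B, hB, hg⟩ := hg
  refine ⟨|a| * B, by positivity, fun n x Y δ hY φ ψ h1 h2 h3 h4 => ?_⟩
  have e1 := hg n x Y δ hY φ ψ h1 h2 h3 h4
  simp only [coordSum, ← Finset.mul_sum] at e1 ⊢
  rw [← mul_sub, abs_mul, mul_assoc]
  exact mul_le_mul_of_nonneg_left e1 (abs_nonneg a)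

lemma IsStable.sum {L : ℕ} {ι : Type*} (s : Finset ι) {g : ι → (Fin L → ZMod 2) → ℝ}
    (hg : ∀ a, IsStable (g a)) : IsStable fun u => ∑ a ∈ s, g a u := by
  classical
  induction s using Finset.induction_on with
  | empty => exact ⟨0, le_rfl, by simp [coordSum]⟩
  | insert a s ha ih => simpa only [Finset.sum_insert ha] using (hg a).add ih

/-- Inclusion–exclusion: the indicator of `u a = 0` is `1` minus that of `u a = 1`, so `A'` can be
emptied. Then the coordinate sum is `onesCount` of `A.image φ`, a set of size `A.card` for every
injective `φ`. -/
lemma isStable_indicator {L : ℕ} (A A' : Finset (Fin L)) :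
    IsStable fun u => if (∀ i ∈ A, u i = 1) ∧ ∀ i ∈ A', u i = 0 then 1 else 0 := by
  induction A' using Finset.induction_on generalizing A with
  | empty =>
    have key : ∀ {n : ℕ} (x : ℕ → Fin n → ZMod 2) (φ : Fin L → ℕ), coordSum x
        (fun u => if (∀ i ∈ A, u i = 1) ∧ ∀ i ∈ (∅ : Finset (Fin L)), u i = 0 then 1 else 0) φ
          = onesCount x (A.image φ) := by
      intro n x φ
      simp [coordSum, onesCount]
    refine ⟨1, zero_le_one, fun n x Y δ hY φ ψ h1 h2 h3 h4 => ?_⟩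
    rw [key, key, one_mul]
    have c1 := Finset.card_image_of_injective A h1
    refine hY _ ?_ _ ?_ (c1.trans (Finset.card_image_of_injective A h2).symm) ?_
    · exact Finset.image_subset_iff.2 fun i _ => h3 i
    · exact Finset.image_subset_iff.2 fun i _ => h4 i
    · rw [c1]; simpa using A.card_le_univ
  | insert a A' ha ih =>
    convert (ih A).add ((ih (insert a A)).const_mul (-1)) using 2 with u
    rcases zmod_two_eq (u a) with h | h <;>
      simp only [Finset.forall_mem_insert, h, true_and, zero_ne_one, one_ne_zero, false_and,
        and_false, if_false]
    · simp
    · split_ifs <;> norm_num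

lemma isStable {L : ℕ} (g : (Fin L → ZMod 2) → ℝ) : IsStable g := by
  have : g = fun u => ∑ v, g v * if (∀ i ∈ Finset.univ.filter fun i => v i = 1, u i = 1) ∧
      ∀ i ∈ Finset.univ.filter fun i => v i = 0, u i = 0 then 1 else 0 := by
    funext u
    rw [Finset.sum_eq_single u]
    · simp
    · intro v _ hv
      rw [if_neg, mul_zero]
      rintro ⟨h1, h2⟩
      refine hv (funext fun i => ?_)
      rcases zmod_two_eq (v i) with h | h
      · rw [h, h2 i (by simp [h])]
      · rw [h, h1 i (by simp [h])]
    · simp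
  rw [this]
  exact IsStable.sum _ fun v => (isStable_indicator _ _).const_mul _

/-! ### The upper bound -/

/-- The majority bit, with ties broken in favour of `0`. -/
def majority {L : ℕ} (u : Fin L → ZMod 2) : ZMod 2 := if 0 ≤ ∑ i, spin (u i) then 0 else 1

lemma spin_majority_mul {L : ℕ} (u : Fin L → ZMod 2) :
    spin (majority u) * ∑ i, spin (u i) = |∑ i, spin (u i)| := by
  unfold majority
  split_ifs with h
  · rw [abs_of_nonneg h, spin_zero, one_mul]
  · rw [abs_of_neg (not_le.1 h), spin_one, neg_one_mul]

lemma majority_comp_equiv {L : ℕ} (u : Fin L → ZMod 2) (σ : Equiv.Perm (Fin L)) :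
    majority (fun i => u (σ i)) = majority u := by
  simp only [majority, Equiv.sum_comp σ fun i => spin (u i)]

lemma two_mul_ite_ne (a b : ZMod 2) : 2 * (if a ≠ b then 1 else 0) = 1 - spin b * spin a := by
  revert a b; decide

lemma two_mul_sum_ite_ne {L : ℕ} (u : Fin L → ZMod 2) (b : ZMod 2) :
    2 * (∑ i, if u i ≠ b then (1 : ℝ) else 0) = L - ((spin b * ∑ i, spin (u i) : ℤ) : ℝ) := by
  have : (2 * ∑ i, if u i ≠ b then (1 : ℤ) else 0) = L - spin b * ∑ i, spin (u i) := by
    rw [Finset.mul_sum, Finset.sum_congr rfl fun i _ => two_mul_ite_ne (u i) b,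
      Finset.sum_sub_distrib, Finset.mul_sum]
    simp
  exact_mod_cast this

/-- Indicator of the event that the `j`-th bit differs from the majority. -/
def minorityAt {L : ℕ} (j : Fin L) (u : Fin L → ZMod 2) : ℝ := if u j ≠ majority u then 1 else 0

lemma sum_minorityAt {L : ℕ} (u : Fin L → ZMod 2) :
    ∑ j, minorityAt j u = (L - ((|∑ i, spin (u i)| : ℤ) : ℝ)) / 2 := by
  rw [eq_div_iff two_ne_zero, mul_comm, ← spin_majority_mul, ← two_mul_sum_ite_ne]
  rfl

lemma coordSum_minorityAt {n L : ℕ} (x : ℕ → Fin n → ZMod 2) (j : Fin L) (φ : Fin L → ℕ) :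
    coordSum x (minorityAt j) φ
      = hammingDist (x (φ j)) fun c => majority fun i => x (φ i) c := by
  simp only [coordSum, minorityAt, hammingDist, Finset.sum_boole]

/-- Permuting the tuple keeps its majority word and only moves the measured position. Stability can
thus compare the distances of different words to one centre. -/
lemma coordSum_minorityAt_comp {n L : ℕ} (x : ℕ → Fin n → ZMod 2) (j : Fin L) (φ : Fin L → ℕ)
    (σ : Equiv.Perm (Fin L)) :
    coordSum x (minorityAt j) (φ ∘ σ) = coordSum x (minorityAt (σ j)) φ := by
  refine Finset.sum_congr rfl fun c _ => ?_
  simp only [minorityAt, Function.comp_apply,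
    majority_comp_equiv (fun i => x (φ i) c) σ]

lemma mul_threshold {L : ℕ} (hL : L ≠ 0) : L * threshold L = (L - walkDistance L) / 2 := by
  have : (L : ℝ) ≠ 0 := by exact_mod_cast hL
  rw [threshold]
  field_simp

/-- With repetitions allowed, the entries of a column are independent with a common bias, so
`walkDistance_le_sum` applies to each column. -/
lemma sum_coordSum_le {n L : ℕ} (hL : L ≠ 0) (x : ℕ → Fin n → ZMod 2) (Y : Finset ℕ)
    (hY : Y.Nonempty) :
    ∑ φ : Fin L → Y, ∑ j, coordSum x (minorityAt j) (fun i => (φ i : ℕ))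
      ≤ n * (Y.card ^ L * (L * threshold L)) := by
  have : Nonempty Y := hY.to_subtype
  simp only [coordSum]
  rw [Finset.sum_congr rfl fun φ _ => Finset.sum_comm, Finset.sum_comm]
  have : ∀ c : Fin n, ∑ φ : Fin L → Y, ∑ j, minorityAt j (fun i => x (φ i) c)
      ≤ Y.card ^ L * (L * threshold L) := by
    intro c
    have h := walkDistance_le_sum (fun k : Y => spin (x k c)) (fun k => spin_eq _) L
    rw [Fintype.card_coe] at h
    simp only [sum_minorityAt]
    rw [← Finset.sum_div, Finset.sum_sub_distrib, mul_threshold hL]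
    simp only [Finset.sum_const, Finset.card_univ, Fintype.card_fun, Fintype.card_coe,
      Fintype.card_fin, nsmul_eq_mul]
    push_cast at h ⊢
    linarith
  refine (Finset.sum_le_sum fun c _ => this c).trans_eq ?_
  simp

/-- Almost all `L`-tuples from a large set are injective; this passes from tuples with repetition to
distinct words. -/
lemma exists_pow_le_descFactorial {L : ℕ} {a b : ℝ} (ha : 0 ≤ a) (hab : a < b) :
    ∃ K : ℕ, L < K ∧ a * (K : ℝ) ^ L ≤ b * K.descFactorial L := by
  have h1 : Tendsto (fun m : ℕ => a * (((L + 1 : ℝ) + 1 * m) / (1 + 1 * m)) ^ L) atTop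
      (nhds (a * (1 / 1) ^ L)) :=
    ((tendsto_add_mul_div_add_mul_atTop_nhds (L + 1 : ℝ) 1 1 one_ne_zero).pow L).const_mul a
  rw [div_one, one_pow, mul_one] at h1
  obtain ⟨m, hm⟩ := (h1.eventually_lt_const hab).exists
  refine ⟨L + 1 + m, by omega, ?_⟩
  have hpos : (0 : ℝ) < (1 + 1 * m) ^ L := by positivity
  rw [div_pow, ← mul_div_assoc, div_lt_iff₀ hpos] at hm
  have h2 : ((m + 2) ^ L : ℕ) ≤ (L + 1 + m).descFactorial L := by
    have := Nat.pow_sub_le_descFactorial (L + 1 + m) L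
    rwa [show L + 1 + m + 1 - L = m + 2 by omega] at this
  have h3 : (1 + 1 * (m : ℝ)) ^ L ≤ (L + 1 + m).descFactorial L := by
    refine le_trans ?_ (Nat.cast_le.2 h2)
    push_cast
    exact pow_le_pow_left₀ (by positivity) (by linarith) L
  push_cast
  rw [one_mul] at hm
  refine hm.le.trans ?_
  rw [one_mul] at h3
  have : 0 ≤ b := ha.trans hab.le
  gcongr

lemma sum_embedding_le {ι κ : Type*} [Fintype ι] [Fintype κ] [DecidableEq ι] [DecidableEq κ]
    (F : (ι → κ) → ℝ) (hF : ∀ φ, 0 ≤ F φ) : ∑ φ : ι ↪ κ, F φ ≤ ∑ φ, F φ := by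
  refine (Finset.sum_map Finset.univ ⟨fun φ : ι ↪ κ => (φ : ι → κ), DFunLike.coe_injective⟩
    F).symm.trans_le ?_
  exact Finset.sum_le_sum_of_subset_of_nonneg (Finset.subset_univ _) fun φ _ _ => hF φ

/-- The Ramsey colours are densities rounded down to multiples of `1 / Q`. -/
lemma abs_sub_le_of_div_eq {n Q a b : ℕ} (hn : 0 < n) (hQ : 0 < Q) (h : a * Q / n = b * Q / n) :
    |(a : ℝ) - b| ≤ n / Q := by
  have key : ∀ {a b : ℕ}, a * Q / n = b * Q / n → (a : ℝ) - b ≤ n / Q := by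
    intro a b h
    have h1 := Nat.div_add_mod (a * Q) n
    have h2 := Nat.div_add_mod (b * Q) n
    have h3 := Nat.mod_lt (a * Q) hn
    rw [h] at h1
    have h4 : a * Q ≤ b * Q + n := by omega
    have h5 : (a : ℝ) * Q ≤ b * Q + n := by exact_mod_cast h4
    rw [le_div_iff₀ (by exact_mod_cast hQ)]
    linarith
  rw [abs_le]
  exact ⟨by linarith [key h.symm], key h⟩

/-- A family of words, all of whose small subfamilies have similar joint statistics, contains `L`
words within a common ball of radius slightly above `n * threshold L`. -/
lemma exists_center {L : ℕ} (hL : 2 ≤ L) {p : ℝ} (hp : threshold L < p) :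
    ∃ K Q : ℕ, 0 < Q ∧ ∀ (n : ℕ) (x : ℕ → Fin n → ZMod 2) (Y : Finset ℕ), Y.card = K →
      (∀ S ⊆ Y, ∀ S' ⊆ Y, S.card = S'.card → S.card ≤ L →
        |(onesCount x S : ℝ) - onesCount x S'| ≤ n / Q) →
      ∃ (φ : Fin L ↪ Y) (y : Fin n → ZMod 2), ∀ j, (hammingDist (x (φ j)) y : ℝ) ≤ n * p := by
  -- The averaging over tuples uses the margin up to `p'`; the stability error uses `p - p'`, which
  -- determines `Q`.
  obtain ⟨p', hp', hp'p⟩ := exists_between hp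
  obtain ⟨K, hLK, hK⟩ := exists_pow_le_descFactorial (L := L) (threshold_nonneg hL) hp'
  choose B hB0 hB using fun j : Fin L => isStable (minorityAt j)
  obtain ⟨Q, hQ⟩ := exists_nat_gt ((∑ j, B j) / (p - p'))
  have hBs : 0 ≤ ∑ j, B j := Finset.sum_nonneg fun j _ => hB0 j
  have hpp : 0 < p - p' := by linarith
  have hQ0 : (0 : ℝ) < Q := lt_of_le_of_lt (by positivity) hQ
  have hL0 : (0 : ℝ) < L := by exact_mod_cast (by omega : 0 < L)
  refine ⟨K, Q, by exact_mod_cast hQ0, fun n x Y hYK hY => ?_⟩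
  have hne : Y.Nonempty := Finset.card_pos.1 (by omega)
  have hemb : Nonempty (Fin L ↪ Y) :=
    Function.Embedding.nonempty_of_card_le (by simp; omega)
  obtain ⟨φ, -, hφ⟩ : ∃ φ ∈ (Finset.univ : Finset (Fin L ↪ Y)),
      ∑ j, coordSum x (minorityAt j) (fun i => (φ i : ℕ)) ≤ n * (L * p') := by
    refine Finset.exists_le_of_sum_le Finset.univ_nonempty ?_
    have e1 := sum_embedding_le (ι := Fin L) (κ := Y)
      (fun φ => ∑ j, coordSum x (minorityAt j) (fun i => (φ i : ℕ)))
      fun φ => Finset.sum_nonneg fun j _ => by rw [coordSum_minorityAt]; positivity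
    have e2 := e1.trans (sum_coordSum_le (by omega) x Y hne)
    have e3 : (n : ℝ) * (Y.card ^ L * (L * threshold L)) ≤ K.descFactorial L * (n * (L * p')) := by
      have : (n * L : ℝ) * (threshold L * K ^ L) ≤ (n * L) * (p' * K.descFactorial L) :=
        mul_le_mul_of_nonneg_left hK (by positivity)
      rw [hYK]
      linarith
    rw [Finset.sum_const, Finset.card_univ, Fintype.card_embedding_eq, Fintype.card_fin,
      Fintype.card_coe, hYK, nsmul_eq_mul]
    exact e2.trans e3
  refine ⟨φ, fun c => majority fun i => x (φ i) c, fun j => (coordSum_minorityAt x j fun i => (φ i : ℕ)).ge.trans ?_⟩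
  set ψ : Fin L → ℕ := fun i => φ i
  have hψ : ψ.Injective := fun a b h => φ.injective (Subtype.ext h)
  -- Swapping `j` and `j'` keeps the centre, so their distances to it differ by at most the
  -- stability error. Averaging over `j'` then bounds each distance by the mean.
  have h1 : ∀ j', coordSum x (minorityAt j) ψ
      ≤ coordSum x (minorityAt j') ψ + (∑ j, B j) * (n / Q) := by
    intro j'
    have h2 := hB j n x Y (n / Q) hY ψ (ψ ∘ Equiv.swap j j') hψ
      (hψ.comp (Equiv.injective _)) (fun i => (φ i).2) (fun i => (φ _).2)
    rw [coordSum_minorityAt_comp, Equiv.swap_apply_left] at h2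
    have h3 : B j * (n / Q) ≤ (∑ j, B j) * (n / Q) := by
      have := Finset.single_le_sum (fun j _ => hB0 j) (Finset.mem_univ j)
      gcongr
    linarith [(abs_le.1 h2).2]
  have h2 := Finset.sum_le_sum fun j' (_ : j' ∈ Finset.univ) => h1 j'
  rw [Finset.sum_add_distrib] at h2
  simp only [Finset.sum_const, Finset.card_univ, Fintype.card_fin, nsmul_eq_mul] at h2
  have h3 : (∑ j, B j) * (n / Q) ≤ n * (p - p') := by
    rw [div_lt_iff₀ hpp] at hQ
    rw [mul_div_assoc', div_le_iff₀ hQ0]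
    nlinarith [(Nat.cast_nonneg n : (0 : ℝ) ≤ n)]
  refine le_of_mul_le_mul_left (a := (L : ℝ)) ?_ hL0
  nlinarith

/-- Above the threshold, list-decodable codes have bounded size. -/
lemma exists_card_lt {L : ℕ} (hL : 2 ≤ L) {p : ℝ} (hp : threshold L < p) :
    ∃ N : ℕ, ∀ (n : ℕ) (C : Finset (Fin n → ZMod 2)), 0 < n → IsListDecodable p L C →
      C.card < N := by
  obtain ⟨K, Q, hQ, hKQ⟩ := exists_center hL hp
  obtain ⟨N, hN⟩ := ramsey_le (Q + 1) L K
  refine ⟨N, fun n C hn hC => not_le.1 fun hNC => ?_⟩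
  let x : ℕ → Fin n → ZMod 2 := fun i => if h : i < C.card then C.equivFin.symm ⟨i, h⟩ else 0
  have hxC : ∀ i < C.card, x i ∈ C := by
    intro i hi
    simp only [x, dif_pos hi, Finset.coe_mem]
  have hxi : ∀ i < C.card, ∀ j < C.card, x i = x j → i = j := by
    intro i hi j hj h
    simp only [x, dif_pos hi, dif_pos hj] at h
    simpa using C.equivFin.symm.injective (Subtype.ext h)
  obtain ⟨Y, hYC, hYK, hY⟩ := hN (Finset.range C.card) (by simpa using hNC)
    (fun S => onesCount x S * Q / n) fun S => by
      rw [Nat.div_lt_iff_lt_mul hn]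
      have : onesCount x S ≤ n := by
        simpa [onesCount] using Finset.card_le_univ (Finset.univ.filter fun c => ∀ j ∈ S, x j c = 1)
      nlinarith
  obtain ⟨φ, y, hφ⟩ := hKQ n x Y hYK fun S hS S' hS' h hSL =>
    abs_sub_le_of_div_eq hn hQ (hY S hS S' hS' h hSL)
  have hlt : ∀ j, (φ j : ℕ) < C.card := fun j => Finset.mem_range.1 (hYC (φ j).2)
  have := Finset.card_le_card_of_injOn (s := (Finset.univ : Finset (Fin L)))
    (t := C.filter fun x => (hammingDist x y : ℝ) ≤ n * p) (fun j => x (φ j))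
    (fun j _ => Finset.mem_filter.2 ⟨hxC _ (hlt j), hφ j⟩)
    fun i _ j _ h => φ.injective (Subtype.ext (hxi _ (hlt i) _ (hlt j) h))
  rw [Finset.card_univ, Fintype.card_fin] at this
  exact absurd (hC y) (not_lt.2 this)

/-! ### The lower bound -/

/-- All the words of the tuple `x` lie in a common ball of radius `n * p`. -/
def IsClustered {n L : ℕ} (p : ℝ) (x : Fin L → Fin n → ZMod 2) : Prop :=
  ∃ y, ∀ i, (hammingDist (x i) y : ℝ) ≤ n * p

/-- The number of bits of a tuple that differ from the majority. -/
noncomputable def minorityCount {L : ℕ} (u : Fin L → ZMod 2) : ℝ :=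
  (L - ((|∑ i, spin (u i)| : ℤ) : ℝ)) / 2

/-- The majority bit is the best centre bit, since `spin b * s ≤ |s|`. -/
lemma minorityCount_le {L : ℕ} (u : Fin L → ZMod 2) (b : ZMod 2) :
    minorityCount u ≤ ∑ i, if u i ≠ b then (1 : ℝ) else 0 := by
  have h1 := two_mul_sum_ite_ne u b
  have h2 : spin b * ∑ i, spin (u i) ≤ |∑ i, spin (u i)| := by
    refine (le_abs_self _).trans_eq ?_
    rcases spin_eq b with h | h <;> simp [h]
  have h3 : ((spin b * ∑ i, spin (u i) : ℤ) : ℝ) ≤ ((|∑ i, spin (u i)| : ℤ) : ℝ) := by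
    exact_mod_cast h2
  rw [minorityCount]
  linarith

lemma IsClustered.sum_minorityCount_le {n L : ℕ} {p : ℝ} {x : Fin L → Fin n → ZMod 2}
    (hx : IsClustered p x) : ∑ c, minorityCount (fun i => x i c) ≤ n * (L * p) := by
  obtain ⟨y, hy⟩ := hx
  calc ∑ c, minorityCount (fun i => x i c)
      ≤ ∑ c, ∑ i, if x i c ≠ y c then (1 : ℝ) else 0 :=
        Finset.sum_le_sum fun c _ => minorityCount_le _ _
    _ = ∑ i, (hammingDist (x i) y : ℝ) := by
        rw [Finset.sum_comm]
        simp only [hammingDist, Finset.sum_boole]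
    _ ≤ ∑ _i : Fin L, n * p := Finset.sum_le_sum fun i _ => hy i
    _ = n * (L * p) := by simp; ring

lemma sum_minorityCount (L : ℕ) :
    ∑ u : Fin L → ZMod 2, minorityCount u = 2 ^ L * ((L - walkDistance L) / 2) := by
  simp only [minorityCount]
  rw [← Finset.sum_div, Finset.sum_sub_distrib, sum_abs_spin]
  simp
  ring

open Classical in
/-- Chernoff's bound for the number of clustered tuples. -/
lemma card_clustered_le (n L : ℕ) (p : ℝ) {a : ℝ} (ha : 0 ≤ a) :
    ((Finset.univ.filter fun x : Fin L → Fin n → ZMod 2 => IsClustered p x).card : ℝ)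
      ≤ (∑ u : Fin L → ZMod 2, Real.exp (a * (L * p - minorityCount u))) ^ n := by
  -- The power expands into a sum over tuples of products over coordinates. A clustered tuple has
  -- total exponent at least `0`, so its term is at least `1`.
  rw [Fintype.sum_pow, ← (Equiv.piComm fun (_ : Fin L) (_ : Fin n) => ZMod 2).sum_comp,
    ← Finset.sum_boole]
  refine Finset.sum_le_sum fun x _ => ?_
  rw [← Real.exp_sum]
  split_ifs with hx
  · rw [Real.one_le_exp_iff, ← Finset.mul_sum, Finset.sum_sub_distrib]
    have := hx.sum_minorityCount_le
    refine mul_nonneg ha (sub_nonneg.2 (this.trans_eq ?_))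
    simp
  · positivity

/-- At `a = 0` the sum is `2 ^ L` with derivative `2 ^ L * L * (p - threshold L) < 0`, so it drops
just to the right of `0`. -/
lemma exists_chernoff_lt {L : ℕ} (hL : L ≠ 0) {p : ℝ} (hp : p < threshold L) :
    ∃ a : ℝ, 0 ≤ a ∧
      ∑ u : Fin L → ZMod 2, Real.exp (a * (L * p - minorityCount u)) < 2 ^ L := by
  set f : ℝ → ℝ := fun a => ∑ u : Fin L → ZMod 2, Real.exp (a * (L * p - minorityCount u))
  have hf : HasDerivAt f (∑ u : Fin L → ZMod 2, (L * p - minorityCount u)) 0 := by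
    refine HasDerivAt.fun_sum fun u _ => ?_
    simpa using ((hasDerivAt_id (0 : ℝ)).mul_const (L * p - minorityCount u)).exp
  have hneg : ∑ u : Fin L → ZMod 2, (L * p - minorityCount u) < 0 := by
    rw [Finset.sum_sub_distrib, sum_minorityCount, ← mul_threshold hL]
    simp only [Finset.sum_const, Finset.card_univ, Fintype.card_fun, Fintype.card_fin, ZMod.card,
      nsmul_eq_mul]
    push_cast
    rw [← mul_sub, ← mul_sub]
    have h1 : (0 : ℝ) < L := by positivity
    have h2 : (0 : ℝ) < 2 ^ L := by positivity
    exact mul_neg_of_pos_of_neg h2 (mul_neg_of_pos_of_neg h1 (sub_neg.2 hp))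
  have hslope := (hasDerivAt_iff_tendsto_slope.1 hf).eventually_lt_const hneg
  have hright : ∀ᶠ a in nhdsWithin (0 : ℝ) (Set.Ioi 0), slope f 0 a < 0 :=
    hslope.filter_mono (nhdsWithin_mono _ fun a (ha : 0 < a) => ha.ne')
  obtain ⟨a, ha, ha0⟩ := (hright.and self_mem_nhdsWithin).exists
  refine ⟨a, le_of_lt ha0, ?_⟩
  have ha0' : 0 < a := ha0
  rw [slope_def_field, sub_zero, div_neg_iff] at ha
  have h0 : f 0 = 2 ^ L := by simp [f]
  rw [h0] at ha
  rcases ha with h | h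
  · exact absurd h.2 (not_lt.2 ha0'.le)
  · exact sub_neg.1 h.1

/-- For uniformly random `x`, the restriction of `x` along an injection is uniformly random. -/
lemma card_comp_embedding {ι κ V : Type*} [Fintype ι] [Fintype κ] [Fintype V] [DecidableEq ι]
    [DecidableEq κ] (e : ι ↪ κ) (P : (ι → V) → Prop) [DecidablePred P] :
    (Finset.univ.filter fun x : κ → V => P (x ∘ e)).card * Fintype.card V ^ Fintype.card ι
      = Fintype.card V ^ Fintype.card κ * (Finset.univ.filter P).card := by
  rw [← Fintype.card_fun, ← Fintype.card_fun, ← Finset.card_univ, ← Finset.card_univ,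
    ← Finset.card_product, ← Finset.card_product]
  -- An involution exchanging the second word with the entries of the first along `e`.
  let Φ : (κ → V) × (ι → V) → (κ → V) × (ι → V) :=
    fun w => (Function.extend e w.2 w.1, w.1 ∘ e)
  have hΦ : ∀ w, Φ (Φ w) = w := by
    rintro ⟨x, z⟩
    refine Prod.ext (funext fun k => ?_) (Function.extend_comp e.injective z x)
    by_cases hk : ∃ i, e i = k
    · obtain ⟨i, rfl⟩ := hk
      exact e.injective.extend_apply _ _ i
    · exact (Function.extend_apply' _ _ k hk).trans (Function.extend_apply' _ _ k hk)
  refine Finset.card_nbij' Φ Φ ?_ ?_ (fun w _ => hΦ w) (fun w _ => hΦ w)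
  · intro w hw
    simpa [Φ] using hw
  · intro w hw
    simp only [Finset.coe_product, Finset.coe_univ, Finset.coe_filter, Finset.mem_univ, true_and,
      Set.mem_prod, Set.mem_univ, Set.mem_ofPred_eq] at hw
    simpa [Φ, Function.extend_comp e.injective] using hw

open Classical in
/-- If clustered `L`-tuples are rare, there is a long sequence of words without any. -/
lemma exists_not_clustered {n L M : ℕ} {p b : ℝ} (hb : 0 ≤ b)
    (hcard : ((Finset.univ.filter fun x : Fin L → Fin n → ZMod 2 => IsClustered p x).card : ℝ)
      ≤ (b * 2 ^ L) ^ n) (hM : (M : ℝ) ^ L * b ^ n < 1) :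
    ∃ x : Fin M → Fin n → ZMod 2, ∀ e : Fin L ↪ Fin M, ¬ IsClustered p (x ∘ e) := by
  by_contra! h
  -- Union bound: at most `M ^ L` embeddings, each bad for a fraction at most `b ^ n` of all `x`.
  have h1 : (Finset.univ : Finset (Fin M → Fin n → ZMod 2)) ⊆
      (Finset.univ : Finset (Fin L ↪ Fin M)).biUnion fun e =>
        Finset.univ.filter fun x => IsClustered p (x ∘ e) := by
    intro x _
    obtain ⟨e, he⟩ := h x
    exact Finset.mem_biUnion.2 ⟨e, Finset.mem_univ _, Finset.mem_filter.2 ⟨Finset.mem_univ _, he⟩⟩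
  have h2 := (Finset.card_le_card h1).trans Finset.card_biUnion_le
  set V : ℝ := ((2 ^ n : ℕ) : ℝ) with hV
  have hV0 : 0 < V := by positivity
  have h3 : ∀ e : Fin L ↪ Fin M,
      ((Finset.univ.filter fun x : Fin M → Fin n → ZMod 2 => IsClustered p (x ∘ e)).card : ℝ)
        ≤ V ^ M * b ^ n := by
    intro e
    have h4 := card_comp_embedding e (IsClustered (n := n) p)
    simp only [Fintype.card_fun, Fintype.card_fin, ZMod.card] at h4
    have h5 : ((Finset.univ.filter fun x : Fin M → Fin n → ZMod 2 =>
        IsClustered p (x ∘ e)).card : ℝ) * V ^ L = V ^ M *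
          ((Finset.univ.filter fun x : Fin L → Fin n → ZMod 2 => IsClustered p x).card : ℝ) := by
      rw [hV]; exact_mod_cast h4
    have h6 : (b * 2 ^ L) ^ n = b ^ n * V ^ L := by
      rw [hV]; push_cast; rw [mul_pow, ← pow_mul, ← pow_mul, mul_comm n L]
    rw [h6] at hcard
    have h7 : V ^ M * ((Finset.univ.filter fun x : Fin L → Fin n → ZMod 2 =>
        IsClustered p x).card : ℝ) ≤ V ^ M * (b ^ n * V ^ L) := by gcongr
    rw [← h5, ← mul_assoc] at h7
    exact le_of_mul_le_mul_right h7 (by positivity)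
  have h8 : V ^ M ≤ ∑ e : Fin L ↪ Fin M, V ^ M * b ^ n := by
    refine le_trans ?_ (Finset.sum_le_sum fun e _ => h3 e)
    simp only [Finset.card_univ, Fintype.card_fun, Fintype.card_fin, ZMod.card] at h2
    rw [hV]
    exact_mod_cast h2
  rw [Finset.sum_const, Finset.card_univ, Fintype.card_embedding_eq, Fintype.card_fin,
    Fintype.card_fin, nsmul_eq_mul] at h8
  have h9 : ((M.descFactorial L : ℕ) : ℝ) ≤ (M : ℝ) ^ L := by
    exact_mod_cast Nat.descFactorial_le_pow M L
  have h10 : (M.descFactorial L : ℝ) * (V ^ M * b ^ n) ≤ V ^ M * ((M : ℝ) ^ L * b ^ n) := by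
    calc (M.descFactorial L : ℝ) * (V ^ M * b ^ n) ≤ (M : ℝ) ^ L * (V ^ M * b ^ n) := by gcongr
      _ = _ := by ring
  have h11 : V ^ M * ((M : ℝ) ^ L * b ^ n) < V ^ M * 1 := by gcongr
  linarith

/-- `x` may repeat words, but `L` equal words are clustered because `0 ≤ p`; so passing to the image
costs at most a factor `L`. -/
lemma exists_code {n L M : ℕ} {p : ℝ} (hp : 0 ≤ p)
    {x : Fin M → Fin n → ZMod 2} (hx : ∀ e : Fin L ↪ Fin M, ¬ IsClustered p (x ∘ e)) :
    ∃ C : Finset (Fin n → ZMod 2), IsListDecodable p L C ∧ M ≤ L * C.card := by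
  have key : ∀ y, (Finset.univ.filter fun i => (hammingDist (x i) y : ℝ) ≤ n * p).card < L := by
    intro y
    by_contra! h
    exact hx (Finset.orderEmbOfCardLe _ h).toEmbedding ⟨y, fun i =>
      (Finset.mem_filter.1 (Finset.orderEmbOfCardLe_mem _ h i)).2⟩
  refine ⟨Finset.univ.image x, fun y => ?_, ?_⟩
  · rw [Finset.filter_image]
    exact Finset.card_image_le.trans_lt (key y)
  · have := Finset.card_le_mul_card_image (f := x) (Finset.univ : Finset (Fin M)) L fun y _ =>
      (Finset.card_le_card fun i hi => ?_).trans (key y).le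
    · simpa using this
    · simp only [Finset.mem_filter, Finset.mem_univ, true_and] at hi ⊢
      rw [hi, hammingDist_self]
      simpa using by positivity

/-- Below the threshold, there are list-decodable codes of positive rate in all large enough
blocklengths. -/
lemma exists_rate_ge {L : ℕ} (hL : L ≠ 0) {p : ℝ} (hp0 : 0 ≤ p) (hp : p < threshold L) :
    ∃ R : ℝ, 0 < R ∧ ∀ᶠ n : ℕ in atTop, ∃ C : Finset (Fin n → ZMod 2),
      IsListDecodable p L C ∧ R ≤ rate C := by
  obtain ⟨a, ha, hS⟩ := exists_chernoff_lt hL hp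
  set b : ℝ := (∑ u : Fin L → ZMod 2, Real.exp (a * (L * p - minorityCount u))) / 2 ^ L with hb
  have hb0 : 0 ≤ b := by positivity
  have hb1 : b < 1 := by rw [hb, div_lt_one (by positivity)]; exact hS
  have hL0 : (0 : ℝ) < L := by positivity
  -- With `M = ⌈L * β ^ n⌉₊` words the union bound is of order `(β ^ L * b) ^ n`. The factor `L`
  -- pays for repetitions in `exists_code`; `L + 1` below absorbs the ceiling, as `1 ≤ β ^ n`.
  obtain ⟨β, hβ, hβ1⟩ : ∃ β : ℝ, β ^ L * b < 1 ∧ 1 < β := by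
    have hc : ContinuousAt (fun β : ℝ => β ^ L * b) 1 := by fun_prop
    have h1 : ∀ᶠ β in nhds (1 : ℝ), β ^ L * b < 1 := hc.eventually_lt_const (by simpa using hb1)
    have h2 : ∀ᶠ β in nhdsWithin (1 : ℝ) (Set.Ioi 1), β ^ L * b < 1 :=
      h1.filter_mono nhdsWithin_le_nhds
    exact (h2.and self_mem_nhdsWithin).exists
  have hβ0 : 0 < β := by linarith
  refine ⟨Real.logb 2 β, Real.logb_pos (by norm_num) hβ1, ?_⟩
  have hlim : Tendsto (fun n : ℕ => (L + 1 : ℝ) ^ L * (β ^ L * b) ^ n) atTop (nhds 0) := by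
    simpa using (tendsto_pow_atTop_nhds_zero_of_lt_one (by positivity) hβ).const_mul
      ((L + 1 : ℝ) ^ L)
  filter_upwards [hlim.eventually_lt_const one_pos, eventually_gt_atTop 0] with n hn hn0
  have hM : ((⌈L * β ^ n⌉₊ : ℕ) : ℝ) ≤ (L + 1) * β ^ n := by
    have h1 := (Nat.ceil_lt_add_one (by positivity : 0 ≤ L * β ^ n)).le
    have h2 := one_le_pow₀ hβ1.le (n := n)
    linarith
  have hM' : ((⌈L * β ^ n⌉₊ : ℕ) : ℝ) ^ L * b ^ n < 1 := by
    refine lt_of_le_of_lt ?_ hn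
    calc ((⌈L * β ^ n⌉₊ : ℕ) : ℝ) ^ L * b ^ n ≤ ((L + 1) * β ^ n) ^ L * b ^ n := by gcongr
      _ = (L + 1 : ℝ) ^ L * (β ^ L * b) ^ n := by
        rw [mul_pow, mul_pow, ← pow_mul, ← pow_mul, mul_comm n L, mul_assoc]
  have hcard := card_clustered_le n L p ha
  rw [show ∑ u : Fin L → ZMod 2, Real.exp (a * (L * p - minorityCount u)) = b * 2 ^ L by
    rw [hb, div_mul_cancel₀ _ (by positivity)]] at hcard
  obtain ⟨x, hx⟩ := exists_not_clustered hb0 hcard hM'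
  obtain ⟨C, hC, hCM⟩ := exists_code hp0 hx
  refine ⟨C, hC, ?_⟩
  have h1 : (L : ℝ) * β ^ n ≤ L * C.card := (Nat.le_ceil _).trans (by exact_mod_cast hCM)
  have h2 : β ^ n ≤ (C.card : ℝ) := le_of_mul_le_mul_left h1 hL0
  have hn0' : (0 : ℝ) < n := by exact_mod_cast hn0
  rw [rate, le_div_iff₀ hn0', mul_comm, ← Real.logb_pow]
  exact Real.logb_le_logb_of_le (by norm_num) (by positivity) h2

/-! ### The capacity -/

lemma bddAbove_rates (L : ℕ) (p : ℝ) (n : ℕ) :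
    BddAbove {R : ℝ | ∃ C : Finset (Fin n → ZMod 2), IsListDecodable p L C ∧ R = rate C} := by
  refine Set.Finite.bddAbove ((Set.finite_range (rate (n := n))).subset ?_)
  rintro R ⟨C, -, rfl⟩
  exact ⟨C, rfl⟩

lemma rate_le_maxRate {L n : ℕ} {p : ℝ} {C : Finset (Fin n → ZMod 2)}
    (hC : IsListDecodable p L C) : rate C ≤ maxRate L p n :=
  le_csSup (bddAbove_rates L p n) ⟨C, hC, rfl⟩

lemma isListDecodable_empty {L : ℕ} (hL : 0 < L) (p : ℝ) (n : ℕ) :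
    IsListDecodable p L (∅ : Finset (Fin n → ZMod 2)) := fun y => by simpa using hL

lemma rate_empty (n : ℕ) : rate (∅ : Finset (Fin n → ZMod 2)) = 0 := by simp [rate]

lemma maxRate_nonneg {L : ℕ} (hL : 0 < L) (p : ℝ) (n : ℕ) : 0 ≤ maxRate L p n :=
  (rate_empty n).ge.trans (rate_le_maxRate (isListDecodable_empty hL p n))

lemma maxRate_le {L : ℕ} (hL : 0 < L) {p : ℝ} {n : ℕ} {R : ℝ}
    (h : ∀ C : Finset (Fin n → ZMod 2), IsListDecodable p L C → rate C ≤ R) :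
    maxRate L p n ≤ R := by
  refine csSup_le ⟨_, ∅, isListDecodable_empty hL p n, rfl⟩ ?_
  rintro _ ⟨C, hC, rfl⟩
  exact h C hC

lemma rate_le_logb_div {n N : ℕ} (hN : 0 < N) {C : Finset (Fin n → ZMod 2)} (hC : C.card ≤ N) :
    rate C ≤ Real.logb 2 N / n := by
  have h1 : (1 : ℝ) ≤ N := by exact_mod_cast hN
  refine div_le_div_of_nonneg_right ?_ (Nat.cast_nonneg n)
  rcases C.card.eq_zero_or_pos with h | h
  -- The empty code has rate `0` because `Real.logb 2 0 = 0`.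
  · rw [h, Nat.cast_zero, Real.logb_zero]
    exact Real.logb_nonneg (by norm_num) h1
  · exact Real.logb_le_logb_of_le (by norm_num) (by exact_mod_cast h) (by exact_mod_cast hC)

lemma tendsto_maxRate_zero {L : ℕ} (hL : 2 ≤ L) {p : ℝ} (hp : threshold L < p) :
    Tendsto (maxRate L p) atTop (nhds 0) := by
  obtain ⟨N, hN⟩ := exists_card_lt hL hp
  refine tendsto_of_tendsto_of_tendsto_of_le_of_le' tendsto_const_nhds
    (tendsto_const_div_atTop_nhds_zero_nat (Real.logb 2 (N + 1 : ℕ)))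
    (Eventually.of_forall fun n => maxRate_nonneg (by omega) p n) ?_
  filter_upwards [eventually_gt_atTop 0] with n hn
  exact maxRate_le (by omega) fun C hC => rate_le_logb_div N.succ_pos (by have := hN n C hn hC; omega)

lemma capacity_eq_zero {L : ℕ} (hL : 2 ≤ L) {p : ℝ} (hp : threshold L < p) : capacity L p = 0 :=
  (tendsto_maxRate_zero hL hp).limsup_eq

lemma not_isAchievable {L : ℕ} (hL : 2 ≤ L) {p : ℝ} (hp : threshold L < p) {R : ℝ} (hR : 0 < R) :
    ¬ IsAchievable L p R := by
  rintro ⟨n, C, hn, hC⟩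
  have h1 : Tendsto (fun i => maxRate L p (n i)) atTop (nhds 0) :=
    (tendsto_maxRate_zero hL hp).comp hn
  obtain ⟨i, hi⟩ := (h1.eventually_lt_const hR).exists
  exact absurd ((hC i).2.trans (rate_le_maxRate (hC i).1)) (not_le.2 hi)

lemma rate_le_one {n : ℕ} (C : Finset (Fin n → ZMod 2)) : rate C ≤ 1 := by
  refine (rate_le_logb_div (N := 2 ^ n) (by positivity) ?_).trans ?_
  · simpa using C.card_le_univ
  · push_cast
    rw [Real.logb_pow, Real.logb_self_eq_one (by norm_num), mul_one]
    exact div_self_le_one _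

lemma le_capacity {L : ℕ} (hL : 0 < L) {p R : ℝ} (h : ∀ᶠ n : ℕ in atTop,
    ∃ C : Finset (Fin n → ZMod 2), IsListDecodable p L C ∧ R ≤ rate C) : R ≤ capacity L p := by
  refine le_limsup_of_frequently_le (Eventually.frequently ?_) ?_
  · filter_upwards [h] with n ⟨C, hC, hR⟩
    exact hR.trans (rate_le_maxRate hC)
  · exact isBoundedUnder_of ⟨1, fun n => maxRate_le hL fun C _ => rate_le_one C⟩

lemma isAchievable_of_eventually {L : ℕ} {p R : ℝ} (h : ∀ᶠ n : ℕ in atTop,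
    ∃ C : Finset (Fin n → ZMod 2), IsListDecodable p L C ∧ R ≤ rate C) : IsAchievable L p R := by
  obtain ⟨N, hN⟩ := eventually_atTop.1 h
  choose C hC using fun i : ℕ => hN (i + N) (Nat.le_add_left N i)
  exact ⟨fun i => i + N, C, tendsto_add_atTop_nat N, hC⟩

/-- The capacity at `threshold L` itself is irrelevant: the set contains everything above it and
nothing below. -/
lemma plotkinPoint_eq {L : ℕ} (hL : 2 ≤ L)
    (hpos : ∀ p : ℝ, 0 ≤ p → p < threshold L → 0 < capacity L p) :
    plotkinPoint L = threshold L := by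
  refine csInf_eq_of_forall_ge_of_forall_gt_exists_lt ?_ ?_ ?_
  · exact ⟨threshold L + 1, by linarith [threshold_nonneg hL],
      capacity_eq_zero hL (by linarith)⟩
  · rintro p ⟨hp0, hp⟩
    exact not_lt.1 fun h => (hpos p hp0 h).ne' hp
  · intro w hw
    obtain ⟨p, h1, h2⟩ := exists_between hw
    exact ⟨p, ⟨(threshold_nonneg hL).trans h1.le, capacity_eq_zero hL h1⟩, h2⟩

end BitFlip

theorem mainTheorem5 (L : ℕ) (hL : 2 ≤ L) :
    BitFlip.plotkinPoint L = (1 - BitFlip.walkDistance L / L) / 2 ∧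
    (∀ p : ℝ, 0 ≤ p → p < (1 - BitFlip.walkDistance L / L) / 2 →
      0 < BitFlip.capacity L p ∧ ∃ R : ℝ, 0 < R ∧ BitFlip.IsAchievable L p R) ∧
    (∀ p : ℝ, (1 - BitFlip.walkDistance L / L) / 2 < p →
      BitFlip.capacity L p = 0 ∧ ¬ ∃ R : ℝ, 0 < R ∧ BitFlip.IsAchievable L p R) ∧
    (∀ k : ℕ, L = 2 * k ∨ L = 2 * k + 1 →
      (1 - BitFlip.walkDistance L / L) / 2 =
        ∑ i ∈ Finset.Icc 1 k,
          ((2 * (i - 1)).choose (i - 1) : ℝ) / (i : ℝ) * (2 : ℝ) ^ (-(2 * (i : ℤ))) ∧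
      (1 - BitFlip.walkDistance L / L) / 2 =
        1 / 2 - (2 : ℝ) ^ (-(2 * (k : ℤ)) - 1) * ((2 * k).choose k : ℝ)) := by
  have hlow : ∀ p : ℝ, 0 ≤ p → p < BitFlip.threshold L →
      0 < BitFlip.capacity L p ∧ ∃ R : ℝ, 0 < R ∧ BitFlip.IsAchievable L p R := by
    intro p hp0 hp
    obtain ⟨R, hR, h⟩ := BitFlip.exists_rate_ge (by omega) hp0 hp
    exact ⟨hR.trans_le (BitFlip.le_capacity (by omega) h), R, hR,
      BitFlip.isAchievable_of_eventually h⟩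
  refine ⟨BitFlip.plotkinPoint_eq hL fun p hp0 hp => (hlow p hp0 hp).1, hlow, fun p hp =>
    ⟨BitFlip.capacity_eq_zero hL hp, ?_⟩, fun k hk => ?_⟩
  · rintro ⟨R, hR, h⟩
    exact BitFlip.not_isAchievable hL hp hR h
  · exact ⟨BitFlip.threshold_eq_sum (by omega) hk, BitFlip.threshold_eq_zpow (by omega) hk⟩
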